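/- Let $p$ be a prime, let $K/F/\mathbb{Q}_p$ be finite field extensions with rings of integers $\mathcal{O}_F\subset\mathcal{O}_K$, let $\pi$ be a uniformizer of $\mathcal{O}_F$ and $q$ the number of elements of its residue field. Let $A$ be a finite nonzero quotient ring of $\mathcal{O}_K$, with residue field $k$. Let $\Phi(t)\in\mathcal{O}_F[[t]]$ be a Lubin--Tate power series for $\pi$ (that is, $\Phi(t)\equiv\pi t$ modulo $t^2$ and $\Phi(t)\equiv t^q$ modulo $\pi$), and for $\gamma\in\Gamma=\mathcal{O}_F^\times$ let $[\gamma]_\Phi(t)\in\mathcal{O}_F[[t]]$ be the power series describing the action of $\gamma$ on the Lubin--Tate group of $\Phi$, i.e. the unique power series with $[\gamma]_\Phi(t)\equiv\gamma t$ modulo $t^2$ and $\Phi([\gamma]_\Phi(t))=[\gamma]_\Phi(\Phi(t))$. Let $D$ be a finite set, $A[[t_\bullet]]=A[[t_d]]_{d\in D}$ and $A((t_\bullet))=A[[t_\bullet]][\prod_{d\in D}t_d^{-1}]$, and define $k((t_\bullet))$ in the same way. Let $\Gamma_\bullet=\prod_{d\in D}\Gamma$ act on $A((t_\bullet))$ by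 $A$-algebra automorphisms extending the substitutions $(\gamma_d)_{d\in D}*t_{d'}=[\gamma_{d'}]_\Phi(t_{d'})$, and let $A((t_\bullet))[\Gamma_\bullet]$ be the corresponding skew group ring, in which $\gamma\cdot x=(\gamma*x)\cdot\gamma$ for $\gamma\in\Gamma_\bullet$ and $x\in A((t_\bullet))$. Let $\mathbf{D}$ be an $A((t_\bullet))[\Gamma_\bullet]$-module, let $\mathbf{D}'\subset\mathbf{D}$ be an $A((t_\bullet))[\Gamma_\bullet]$-submodule, and let $\alpha\in A((t_\bullet))$ with $\alpha\mathbf{D}'=0$. If the image of $\alpha$ in $k((t_\bullet))$ is nonzero, then $\mathbf{D}'=0$. -/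

import Mathlib

noncomputable section

namespace LubinTate

/-- A `ℚ_p`-algebra, regarded as a `ℤ_p`-algebra. -/
@[reducible] def padicIntAlgebra (p : ℕ) [Fact p.Prime] (F : Type*) [Field F] [Algebra ℚ_[p] F] :
    Algebra ℤ_[p] F :=
  ((algebraMap ℚ_[p] F).comp (algebraMap ℤ_[p] ℚ_[p])).toAlgebra

/-- The ring of integers `𝒪_F` of a finite extension `F` of `ℚ_p`: the integral closure of `ℤ_p`
in `F`. -/
def integers (p : ℕ) [Fact p.Prime] (F : Type*) [Field F] [Algebra ℚ_[p] F] : Subring F :=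
  letI := padicIntAlgebra p F
  (integralClosure ℤ_[p] F).toSubring

section Integers

variable (p : ℕ) [Fact p.Prime] (F K : Type*) [Field F] [Field K] [Algebra ℚ_[p] F]
  [Algebra ℚ_[p] K] [Algebra F K] [IsScalarTower ℚ_[p] F K]

theorem mem_integers_iff (x : F) :
    x ∈ integers p F ↔
      ((algebraMap ℚ_[p] F).comp (algebraMap ℤ_[p] ℚ_[p])).IsIntegralElem x :=
  Iff.rfl

theorem algebraMap_mem_integers {x : F} (hx : x ∈ integers p F) :
    algebraMap F K x ∈ integers p K := by
  rw [mem_integers_iff] at hx ⊢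
  obtain ⟨f, hf, h⟩ := hx
  refine ⟨f, hf, ?_⟩
  have := congrArg (algebraMap F K) h
  rw [Polynomial.hom_eval₂, map_zero, ← RingHom.comp_assoc,
    ← IsScalarTower.algebraMap_eq] at this
  exact this

/-- The inclusion `𝒪_F → 𝒪_K` for an extension `K / F`. -/
instance integersAlgebra : Algebra (integers p F) (integers p K) :=
  (((algebraMap F K).comp (integers p F).subtype).codRestrict (integers p K)
    fun x => algebraMap_mem_integers p F K x.2).toAlgebra

variable [FiniteDimensional ℚ_[p] F]

theorem mem_integers_iff_spectralNorm (x : F) :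
    x ∈ integers p F ↔ spectralNorm ℚ_[p] F x ≤ 1 := by
  let := padicIntAlgebra p F
  have : IsScalarTower ℤ_[p] ℚ_[p] F := IsScalarTower.of_algebraMap_eq fun _ => rfl
  have hx : IsIntegral ℚ_[p] x := Algebra.IsIntegral.isIntegral x
  rw [spectralNorm, spectralValue_le_one_iff (minpoly.monic hx)]
  constructor
  · intro h
    have h' : IsIntegral ℤ_[p] x := h
    rw [show minpoly ℚ_[p] x = _ from minpoly.isIntegrallyClosed_eq_field_fractions' ℚ_[p] h']
    intro n
    rw [Polynomial.coeff_map]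
    exact ((minpoly ℤ_[p] x).coeff n).2
  · intro h
    have hl : minpoly ℚ_[p] x ∈ Polynomial.lifts (algebraMap ℤ_[p] ℚ_[p]) := by
      rw [Polynomial.lifts_iff_coeff_lifts]
      exact fun n => ⟨⟨_, h n⟩, rfl⟩
    obtain ⟨q, hq, -, hm⟩ := Polynomial.lifts_and_degree_eq_and_monic hl (minpoly.monic hx)
    refine (show IsIntegral ℤ_[p] x from ⟨q, hm, ?_⟩)
    have := minpoly.aeval ℚ_[p] x
    rw [← hq, Polynomial.aeval_map_algebraMap] at this
    exact this

instance integers_valuationRing : ValuationRing (integers p F) := by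
  have key : ∀ x : F, x ∈ integers p F ∨ x⁻¹ ∈ integers p F := by
    intro x
    simp only [mem_integers_iff_spectralNorm]
    let := spectralNorm.normedField ℚ_[p] F
    change ‖x‖ ≤ 1 ∨ ‖x⁻¹‖ ≤ 1
    rw [norm_inv]
    rcases le_total ‖x‖ 1 with h | h
    · exact Or.inl h
    · exact Or.inr (inv_le_one_of_one_le₀ h)
  refine { cond' := fun a b => ?_ }
  by_cases hb : b = 0
  · exact ⟨0, Or.inl (by simp [hb])⟩
  by_cases ha : a = 0
  · exact ⟨0, Or.inr (by simp [ha])⟩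
  have ha' : (a : F) ≠ 0 := fun h => ha (Subtype.ext h)
  have hb' : (b : F) ≠ 0 := fun h => hb (Subtype.ext h)
  rcases key ((b : F) / a) with h | h
  · exact ⟨⟨_, h⟩, Or.inl (Subtype.ext (by simp; field_simp))⟩
  · exact ⟨⟨_, h⟩, Or.inr (Subtype.ext (by simp; field_simp))⟩

instance integers_isNoetherianRing : IsNoetherianRing (integers p F) := by
  let := padicIntAlgebra p F
  have : IsScalarTower ℤ_[p] ℚ_[p] F := IsScalarTower.of_algebraMap_eq fun _ => rfl
  exact integralClosure.isNoetherianRing (A := ℤ_[p]) (K := ℚ_[p]) (L := F)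

instance integers_isDiscreteValuationRing : IsDiscreteValuationRing (integers p F) := by
  have hp : ((p : ℕ) : integers p F) ≠ 0 := by
    intro h
    have h1 : ((p : ℕ) : F) = 0 := by simpa using congrArg Subtype.val h
    have : CharZero F := charZero_of_injective_algebraMap (R := ℚ_[p])
      (algebraMap ℚ_[p] F).injective
    exact Nat.cast_ne_zero.mpr (Fact.out : p.Prime).ne_zero h1
  have hnf : ¬ IsField (integers p F) := by
    intro hF
    obtain ⟨b, hb⟩ := hF.mul_inv_cancel hp
    have h1 := (mem_integers_iff_spectralNorm p F _).mp b.2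
    let := spectralNorm.normedField ℚ_[p] F
    have h2 : ‖(b : F)‖ ≤ 1 := h1
    have h3 : ((p : ℕ) : F) * (b : F) = 1 := by simpa using congrArg Subtype.val hb
    have h4 : ‖((p : ℕ) : F)‖ = (p : ℝ)⁻¹ := by
      have : ((p : ℕ) : F) = algebraMap ℚ_[p] F (p : ℚ_[p]) := by simp
      rw [this]
      exact (spectralNorm_extends _).trans (Padic.norm_p)
    have h5 := congrArg norm h3
    rw [norm_mul, h4, norm_one] at h5
    have hp1 : (1 : ℝ) < p := by exact_mod_cast (Fact.out : p.Prime).one_lt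
    have : (p : ℝ)⁻¹ < 1 := inv_lt_one_of_one_lt₀ hp1
    have h6 : ‖(b : F)‖ = p := by
      have hp0 : (p : ℝ) ≠ 0 := by positivity
      field_simp at h5
      exact h5
    linarith
  have tfae := IsDiscreteValuationRing.TFAE (integers p F) hnf
  have h := tfae.out 0 1
  exact h.mpr (integers_valuationRing p F)

instance integers_finite_residueField :
    Finite (IsLocalRing.ResidueField (integers p F)) := by
  let := padicIntAlgebra p F
  have : IsScalarTower ℤ_[p] ℚ_[p] F := IsScalarTower.of_algebraMap_eq fun _ => rfl
  let S := integralClosure ℤ_[p] F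
  have : IsLocalRing S := inferInstanceAs (IsLocalRing (integers p F))
  have : Module.Finite ℤ_[p] S := IsIntegralClosure.finite ℤ_[p] ℚ_[p] F S
  have : FaithfulSMul ℤ_[p] F := by
    rw [faithfulSMul_iff_algebraMap_injective]
    exact (algebraMap ℚ_[p] F).injective.comp Subtype.val_injective
  have : FaithfulSMul ℤ_[p] S := by
    rw [faithfulSMul_iff_algebraMap_injective]
    exact .of_comp (f := S.val) (FaithfulSMul.algebraMap_injective ℤ_[p] F)
  have : Finite (IsLocalRing.ResidueField ℤ_[p]) :=
    .of_equiv _ (PadicInt.residueField (p := p)).symm.toEquiv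
  exact IsLocalRing.ResidueField.finite_of_finite (R := ℤ_[p]) (S := S) inferInstance

/-- A nonzero quotient of `𝒪_F` is a local ring. -/
instance quotient_isLocalRing (I : Ideal (integers p F)) [Nontrivial (integers p F ⧸ I)] :
    IsLocalRing (integers p F ⧸ I) :=
  IsLocalRing.of_surjective' (Ideal.Quotient.mk I) Ideal.Quotient.mk_surjective

end Integers


open PowerSeries


/-- A Lubin–Tate formal power series over the ring of integers `O` of a local field: a uniformizer
`π` of `O` together with a power series `Φ(t) ∈ O[[t]]` such that `Φ(t) ≡ π t` modulo `t²` and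
`Φ(t) ≡ t^q` modulo `π`, where `q` is the number of elements of the residue field of `O`. -/
structure LubinTateSeries (O : Type*) [CommRing O] [IsDomain O] [IsDiscreteValuationRing O] where
  /-- the uniformizer `π` -/
  uniformizer : O
  irreducible : Irreducible uniformizer
  /-- the power series `Φ(t)` -/
  series : O⟦X⟧
  coeff_zero : coeff 0 series = 0
  coeff_one : coeff 1 series = uniformizer
  frobenius : ∀ n, uniformizer ∣
    coeff n (series - X ^ Nat.card (IsLocalRing.ResidueField O))

theorem X_pow_dvd_subst_sub {R : Type*} [CommRing R] (f : R⟦X⟧) {g h : R⟦X⟧}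
    (hg : coeff 0 g = 0) (hh : coeff 0 h = 0) {n : ℕ} (hgh : X ^ n ∣ g - h) :
    X ^ n ∣ f.subst g - f.subst h := by
  have hg' : HasSubst g := .of_constantCoeff_zero' (by simpa using hg)
  have hh' : HasSubst h := .of_constantCoeff_zero' (by simpa using hh)
  rw [X_pow_dvd_iff] 
  intro m hm
  rw [map_sub, coeff_subst' hg', coeff_subst' hh', sub_eq_zero]
  refine finsum_congr fun d => ?_
  congr 1
  have := X_pow_dvd_iff.mp (hgh.trans (sub_dvd_pow_sub_pow g h d)) m hm
  rwa [map_sub, sub_eq_zero] at this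

theorem subst_dvd {R : Type*} [CommRing R] (f : R⟦X⟧) (hf : coeff 0 f = 0) {g h : R⟦X⟧}
    {n : ℕ} (hgh : X ^ n ∣ g - h) : X ^ n ∣ g.subst f - h.subst f := by
  have hf' : HasSubst f := .of_constantCoeff_zero' (by simpa using hf)
  obtain ⟨r, hr⟩ := hgh
  rw [← subst_sub hf', hr, subst_mul hf', subst_pow hf', subst_X hf']
  refine Dvd.dvd.mul_right (pow_dvd_pow_of_dvd ?_ n) _
  rwa [X_dvd_iff, ← coeff_zero_eq_constantCoeff_apply]

theorem coeff_subst_add_left {R : Type*} [CommRing R] (f : R⟦X⟧) {g : R⟦X⟧}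
    (hg : coeff 0 g = 0) {n : ℕ} (hn : 1 ≤ n) (c : R) :
    coeff n (f.subst (g + C c * X ^ n)) = coeff n (f.subst g) + coeff 1 f * c := by
  have hh : coeff 0 (g + C c * X ^ n) = 0 := by
    rw [map_add, hg, coeff_C_mul, coeff_X_pow]; simp; omega
  have hg' : HasSubst g := .of_constantCoeff_zero' (by simpa using hg)
  have hh' : HasSubst (g + C c * X ^ n) := .of_constantCoeff_zero' (by simpa using hh)
  obtain ⟨s, hs⟩ : ∃ s : R⟦X⟧, f = C (coeff 0 f) + C (coeff 1 f) * X + X ^ 2 * s := by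
    have : X ^ 2 ∣ f - (C (coeff 0 f) + C (coeff 1 f) * X) := by
      rw [X_pow_dvd_iff]
      intro m hm
      interval_cases m <;> simp [coeff_C]
    obtain ⟨s, hs⟩ := this
    exact ⟨s, by rw [← hs]; ring⟩
  have key : ∀ k : R⟦X⟧, HasSubst k →
      f.subst k = C (coeff 0 f) + C (coeff 1 f) * k + k ^ 2 * s.subst k := by
    intro k hk
    conv_lhs => rw [hs]
    rw [subst_add hk, subst_add hk, subst_mul hk, subst_mul hk, subst_pow hk, subst_X hk,
      subst_C, subst_C]
    rfl
  have hd : X ^ (n + 1) ∣ f.subst (g + C c * X ^ n) - (f.subst g + C (coeff 1 f * c) * X ^ n) := by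
    obtain ⟨g', rfl⟩ : X ∣ g := by rwa [X_dvd_iff, ← coeff_zero_eq_constantCoeff_apply]
    obtain ⟨r, hr⟩ := X_pow_dvd_subst_sub s hh hg (n := n) ⟨C c, by ring⟩
    obtain ⟨m, rfl⟩ := Nat.exists_eq_add_of_le hn
    rw [key _ hh', key _ hg', sub_eq_iff_eq_add.mp hr]
    refine ⟨X * g' ^ 2 * r + (2 * g' * C c + X ^ m * C c ^ 2) * (X ^ (1 + m) * r +
      s.subst (X * g')), ?_⟩
    rw [map_mul]
    ring
  have := X_pow_dvd_iff.mp hd n (Nat.lt_succ_self n)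
  rw [map_sub, map_add, coeff_C_mul, coeff_X_pow_self, mul_one, sub_eq_zero] at this
  exact this

theorem coeff_subst_add_right {R : Type*} [CommRing R] (f : R⟦X⟧) (hf : coeff 0 f = 0) (g : R⟦X⟧)
    (n : ℕ) (c : R) :
    coeff n ((g + C c * X ^ n).subst f) = coeff n (g.subst f) + coeff 1 f ^ n * c := by
  have hf' : HasSubst f := .of_constantCoeff_zero' (by simpa using hf)
  rw [subst_add hf', subst_mul hf', subst_pow hf', subst_X hf', subst_C]
  obtain ⟨f', rfl⟩ : X ∣ f := by rwa [X_dvd_iff, ← coeff_zero_eq_constantCoeff_apply]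
  change coeff n (g.subst (X * f') + C c * (X * f') ^ n) = _
  have h1 : coeff n ((X * f') ^ n) = coeff 0 (f' ^ n) := by
    have := coeff_X_pow_mul (f' ^ n) n 0
    rwa [zero_add, ← mul_pow] at this
  have h2 : coeff 1 (X * f') = coeff 0 f' := coeff_succ_X_mul 0 f'
  rw [map_add, coeff_C_mul, h1, h2, coeff_zero_eq_constantCoeff_apply, map_pow,
    coeff_zero_eq_constantCoeff_apply, mul_comm c]

namespace LubinTateSeries

variable {O : Type*} [CommRing O] [IsDomain O] [IsDiscreteValuationRing O]
  (Φ : LubinTateSeries O)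

theorem hasSubst_series : HasSubst Φ.series :=
  .of_constantCoeff_zero' (by simpa using Φ.coeff_zero)

theorem isUnit_pow_sub_one {n : ℕ} (hn : 1 ≤ n) : IsUnit (Φ.uniformizer ^ n - 1) := by
  have h : Φ.uniformizer ^ n ∈ IsLocalRing.maximalIdeal O := by
    rw [IsLocalRing.mem_maximalIdeal, mem_nonunits_iff, isUnit_pow_iff (by omega)]
    exact Φ.irreducible.not_isUnit
  rw [← neg_sub, IsUnit.neg_iff]
  by_contra h'
  have := Ideal.add_mem _ ((IsLocalRing.mem_maximalIdeal _).mpr h') h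
  exact (Ideal.ne_top_iff_one _).mp (IsLocalRing.maximalIdeal.isMaximal O).ne_top (by simp at this)

theorem bracket_unique {g h : O⟦X⟧} (hg0 : coeff 0 g = 0) (hh0 : coeff 0 h = 0)
    (h1 : coeff 1 g = coeff 1 h)
    (hg : Φ.series.subst g = g.subst Φ.series) (hh : Φ.series.subst h = h.subst Φ.series) :
    g = h := by
  ext n
  induction n using Nat.strong_induction_on with
  | _ n ih =>
    match n, ih with
    | 0, _ => rw [hg0, hh0]
    | 1, _ => exact h1
    | k + 2, ih =>
      set n := k + 2 with hn
      set c := coeff n g - coeff n h with hc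
      have hd : X ^ (n + 1) ∣ g - (h + C c * X ^ n) := by
        rw [X_pow_dvd_iff]
        intro m hm
        rw [map_sub, map_add, coeff_C_mul, coeff_X_pow]
        rcases Nat.lt_succ_iff_lt_or_eq.mp hm with hm | rfl
        · rw [ih m hm, if_neg hm.ne]; ring
        · rw [if_pos rfl, hc]; ring
      have hk0 : coeff 0 (h + C c * X ^ n) = 0 := by
        rw [map_add, hh0, coeff_C_mul, coeff_X_pow]; simp [hn]
      have e1 := X_pow_dvd_iff.mp (X_pow_dvd_subst_sub Φ.series hg0 hk0 hd) n (Nat.lt_succ_self n)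
      have e2 := X_pow_dvd_iff.mp (subst_dvd Φ.series Φ.coeff_zero hd) n (Nat.lt_succ_self n)
      rw [map_sub, coeff_subst_add_left _ hh0 (by omega), sub_eq_zero, Φ.coeff_one] at e1
      rw [map_sub, coeff_subst_add_right _ Φ.coeff_zero, sub_eq_zero, Φ.coeff_one] at e2
      rw [hg, hh, e2] at e1
      have e3 : Φ.uniformizer * (Φ.uniformizer ^ (k + 1) - 1) * c = 0 := by
        rw [hn] at e1; linear_combination e1
      rcases mul_eq_zero.mp e3 with h' | h'
      · rcases mul_eq_zero.mp h' with h' | h'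
        · exact absurd h' Φ.irreducible.ne_zero
        · exact absurd h' (Φ.isUnit_pow_sub_one (by omega)).ne_zero
      · exact sub_eq_zero.mp h'

theorem pow_card_eq_subst {k : Type*} [Field k] [Finite k] (g : k⟦X⟧) :
    g ^ Nat.card k = g.subst (X ^ Nat.card k : k⟦X⟧) := by
  have := Fintype.ofFinite k
  obtain ⟨p, hp⟩ := CharP.exists k
  obtain ⟨n, hpp, hn⟩ := FiniteField.card k p
  have : Fact p.Prime := ⟨hpp⟩
  have h0 : p ^ (n : ℕ) ≠ 0 := pow_ne_zero _ hpp.ne_zero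
  have := MvPowerSeries.map_iterateFrobenius_expand p hpp.ne_zero g n
  have hid : iterateFrobenius k p n = RingHom.id k := by
    ext x
    rw [iterateFrobenius_def, ← hn, FiniteField.pow_card, RingHom.id_apply]
  rw [Nat.card_eq_fintype_card, hn, ← PowerSeries.expand_apply _ h0]
  rw [hid, MvPowerSeries.map_id] at this
  exact this.symm

theorem uniformizer_dvd_iff (a : O) :
    Φ.uniformizer ∣ a ↔ IsLocalRing.residue O a = 0 := by
  rw [IsLocalRing.residue_eq_zero_iff, Φ.irreducible.maximalIdeal_eq, Ideal.mem_span_singleton]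

variable [Finite (IsLocalRing.ResidueField O)]

theorem uniformizer_dvd_coeff {g : O⟦X⟧} (hg : coeff 0 g = 0) (n : ℕ) :
    Φ.uniformizer ∣ coeff n (Φ.series.subst g - g.subst Φ.series) := by
  have hg' : HasSubst g := .of_constantCoeff_zero' (by simpa using hg)
  have hΦ : PowerSeries.map (IsLocalRing.residue O) Φ.series =
      X ^ Nat.card (IsLocalRing.ResidueField O) := by
    ext m
    have := (Φ.uniformizer_dvd_iff _).mp (Φ.frobenius m)
    rw [map_sub, map_sub, sub_eq_zero] at this
    rw [coeff_map, this, coeff_X_pow, coeff_X_pow]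
    split_ifs <;> simp
  rw [uniformizer_dvd_iff, ← coeff_map, map_sub]
  have e1 : PowerSeries.map (IsLocalRing.residue O) (Φ.series.subst g) = 
     (PowerSeries.map (IsLocalRing.residue O) Φ.series).subst (PowerSeries.map (IsLocalRing.residue O) g) :=
    PowerSeries.map_subst hg' _
  have e2 : PowerSeries.map (IsLocalRing.residue O) (g.subst Φ.series) = 
     (PowerSeries.map (IsLocalRing.residue O) g).subst (PowerSeries.map (IsLocalRing.residue O) Φ.series) :=
    PowerSeries.map_subst Φ.hasSubst_series _
  have hg'' : HasSubst (PowerSeries.map (IsLocalRing.residue O) g) :=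
    .of_constantCoeff_zero' (by rw [← coeff_zero_eq_constantCoeff_apply, coeff_map, hg, map_zero])
  rw [e1, e2, hΦ, subst_pow hg'', subst_X hg'', pow_card_eq_subst, sub_self, map_zero]

theorem exists_approx (a : O) : ∃ G : ℕ → O⟦X⟧, ∀ n,
    coeff 0 (G n) = 0 ∧ coeff 1 (G n) = a ∧ X ^ (n + 2) ∣ G (n + 1) - G n ∧
    X ^ (n + 2) ∣ Φ.series.subst (G n) - (G n).subst Φ.series := by
  have step : ∀ n (g : O⟦X⟧), coeff 0 g = 0 → coeff 1 g = a →
      X ^ (n + 2) ∣ Φ.series.subst g - g.subst Φ.series →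
      ∃ g' : O⟦X⟧, coeff 0 g' = 0 ∧ coeff 1 g' = a ∧ X ^ (n + 2) ∣ g' - g ∧
        X ^ (n + 3) ∣ Φ.series.subst g' - g'.subst Φ.series := by
    intro n g h0 h1 hd
    obtain ⟨e, he⟩ := Φ.uniformizer_dvd_coeff h0 (n + 2)
    obtain ⟨u, hu⟩ := Φ.isUnit_pow_sub_one (n := n + 1) (by omega)
    set c : O := ↑u⁻¹ * e with hc
    have huc : (Φ.uniformizer ^ (n + 1) - 1) * c = e := by rw [← hu, hc, Units.mul_inv_cancel_left]
    refine ⟨g + C c * X ^ (n + 2), ?_, ?_, ⟨C c, by ring⟩, ?_⟩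
    · rw [map_add, h0, coeff_C_mul, coeff_X_pow]; simp
    · rw [map_add, h1, coeff_C_mul, coeff_X_pow]; simp
    · have hk0 : coeff 0 (g + C c * X ^ (n + 2)) = 0 := by
        rw [map_add, h0, coeff_C_mul, coeff_X_pow]; simp
      have hsub : X ^ (n + 2) ∣ (g + C c * X ^ (n + 2)) - g := ⟨C c, by ring⟩
      rw [X_pow_dvd_iff]
      intro m hm
      rcases Nat.lt_succ_iff_lt_or_eq.mp hm with hm | rfl
      · have a1 := X_pow_dvd_iff.mp (X_pow_dvd_subst_sub Φ.series hk0 h0 hsub) m hm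
        have a2 := X_pow_dvd_iff.mp (subst_dvd Φ.series Φ.coeff_zero hsub) m hm
        have a3 := X_pow_dvd_iff.mp hd m hm
        rw [map_sub] at a1 a2 a3 ⊢
        linear_combination a1 - a2 + a3
      · rw [map_sub] at he
        rw [map_sub, coeff_subst_add_left _ h0 (by omega), coeff_subst_add_right _ Φ.coeff_zero,
          Φ.coeff_one]
        linear_combination he - Φ.uniformizer * huc
  have hC : X ^ (0 + 2) ∣ Φ.series.subst (C a * X : O⟦X⟧) - (C a * X : O⟦X⟧).subst Φ.series := by
    have z0 : coeff 0 (0 : O⟦X⟧) = 0 := by simp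
    have b1 := coeff_subst_add_left Φ.series z0 (n := 1) le_rfl a
    have b2 := coeff_subst_add_right Φ.series Φ.coeff_zero 0 1 a
    have hs0 : HasSubst (0 : O⟦X⟧) := .zero'
    have b3 : Φ.series.subst (0 : O⟦X⟧) = 0 :=
      subst_zero_of_constantCoeff_zero (by simpa using Φ.coeff_zero)
    have b4 : (0 : O⟦X⟧).subst Φ.series = (0 : O⟦X⟧) := by
      rw [← coe_substAlgHom Φ.hasSubst_series, map_zero]
    rw [zero_add, pow_one] at b1 b2
    have hsub : X ^ 1 ∣ (C a * X : O⟦X⟧) - 0 := ⟨C a, by ring⟩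
    have a1 := X_pow_dvd_iff.mp (X_pow_dvd_subst_sub Φ.series (by simp) z0 hsub) 0 one_pos
    have a2 := X_pow_dvd_iff.mp (subst_dvd Φ.series Φ.coeff_zero hsub) 0 one_pos
    rw [b3, sub_zero] at a1
    rw [b4, sub_zero] at a2
    rw [X_pow_dvd_iff]
    intro m hm
    interval_cases m
    · rw [map_sub, a1, a2, sub_zero]
    · rw [map_sub, b1, b2, b3, b4, pow_one, sub_self]
  let P : ℕ → O⟦X⟧ → Prop := fun n g => coeff 0 g = 0 ∧ coeff 1 g = a ∧
    X ^ (n + 2) ∣ Φ.series.subst g - g.subst Φ.series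
  let G : (n : ℕ) → {g : O⟦X⟧ // P n g} := fun n => Nat.rec
    ⟨C a * X, by simp, by simp, hC⟩
    (fun n g => ⟨(step n g.1 g.2.1 g.2.2.1 g.2.2.2).choose,
      (step n g.1 g.2.1 g.2.2.1 g.2.2.2).choose_spec.1,
      (step n g.1 g.2.1 g.2.2.1 g.2.2.2).choose_spec.2.1,
      (step n g.1 g.2.1 g.2.2.1 g.2.2.2).choose_spec.2.2.2⟩) n
  exact ⟨fun n => (G n).1, fun n => ⟨(G n).2.1, (G n).2.2.1,
    (step n (G n).1 (G n).2.1 (G n).2.2.1 (G n).2.2.2).choose_spec.2.2.1, (G n).2.2.2⟩⟩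

theorem exists_bracket (a : O) : ∃ g : O⟦X⟧, coeff 0 g = 0 ∧ coeff 1 g = a ∧
    Φ.series.subst g = g.subst Φ.series := by
  obtain ⟨G, hG⟩ := Φ.exists_approx a
  let g : O⟦X⟧ := PowerSeries.mk fun n => coeff n (G n)
  have hst : ∀ n m, m ≤ n + 1 → ∀ j, coeff m (G (n + j)) = coeff m (G n) := by
    intro n m hm j
    induction j with
    | zero => rfl
    | succ j ih =>
      rw [← ih]
      have := X_pow_dvd_iff.mp (hG (n + j)).2.2.1 m (by omega)
      rwa [map_sub, sub_eq_zero] at this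
  have hg : ∀ n, X ^ (n + 1) ∣ g - G n := by
    intro n
    rw [X_pow_dvd_iff]
    intro m hm
    rw [map_sub, coeff_mk, sub_eq_zero]
    have := hst m m (by omega) (n - m)
    rw [show m + (n - m) = n by omega] at this
    exact this.symm
  have g0 : coeff 0 g = 0 := by rw [coeff_mk]; exact (hG 0).1
  refine ⟨g, g0, by rw [coeff_mk]; exact (hG 1).2.1, ?_⟩
  ext n
  have a1 := X_pow_dvd_iff.mp (X_pow_dvd_subst_sub Φ.series g0 (hG n).1 (hg n)) n (by omega)
  have a2 := X_pow_dvd_iff.mp (subst_dvd Φ.series Φ.coeff_zero (hg n)) n (by omega)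
  have a3 := X_pow_dvd_iff.mp (hG n).2.2.2 n (by omega)
  rw [map_sub] at a1 a2 a3
  linear_combination a1 - a2 + a3

/-- The power series `[a]_Φ(t) ∈ O[[t]]` describing the action of `a ∈ O` on the Lubin–Tate group
of `Φ`: the unique power series with `[a]_Φ(t) ≡ a t` modulo `t²` and
`Φ([a]_Φ(t)) = [a]_Φ(Φ(t))` (see `exists_bracket` for existence, `bracket_unique` for
uniqueness). -/
def bracket (a : O) : O⟦X⟧ := (Φ.exists_bracket a).choose

theorem coeff_zero_bracket (a : O) : coeff 0 (Φ.bracket a) = 0 :=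
  (Φ.exists_bracket a).choose_spec.1

theorem coeff_one_bracket (a : O) : coeff 1 (Φ.bracket a) = a :=
  (Φ.exists_bracket a).choose_spec.2.1

theorem subst_bracket (a : O) :
    Φ.series.subst (Φ.bracket a) = (Φ.bracket a).subst Φ.series :=
  (Φ.exists_bracket a).choose_spec.2.2

theorem hasSubst_bracket (a : O) : HasSubst (Φ.bracket a) :=
  .of_constantCoeff_zero' (by simpa using Φ.coeff_zero_bracket a)

theorem bracket_one : Φ.bracket 1 = X := by
  refine Φ.bracket_unique (Φ.coeff_zero_bracket 1) (by simp) ?_ (Φ.subst_bracket 1) ?_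
  · rw [coeff_one_bracket, coeff_one_X]
  · rw [subst_X Φ.hasSubst_series, X_subst]

theorem bracket_mul (a b : O) :
    Φ.bracket (a * b) = (Φ.bracket a).subst (Φ.bracket b) := by
  have ha := Φ.hasSubst_bracket a
  have hb := Φ.hasSubst_bracket b
  have hΦ := Φ.hasSubst_series
  have h0 : coeff 0 ((Φ.bracket a).subst (Φ.bracket b)) = 0 := by
    have := X_pow_dvd_iff.mp (X_pow_dvd_subst_sub (Φ.bracket a) (Φ.coeff_zero_bracket b)
      (h := 0) (by simp) (n := 1) ?_) 0 one_pos
    · rwa [subst_zero_of_constantCoeff_zero (by simpa using Φ.coeff_zero_bracket a),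
        sub_zero] at this
    · rw [pow_one, sub_zero, X_dvd_iff, ← coeff_zero_eq_constantCoeff_apply, coeff_zero_bracket]
  have h1 : coeff 1 ((Φ.bracket a).subst (Φ.bracket b)) = a * b := by
    have c0 := coeff_subst_add_left (Φ.bracket a) (g := 0) (by simp) (n := 1) le_rfl b
    have := X_pow_dvd_iff.mp (X_pow_dvd_subst_sub (Φ.bracket a) (Φ.coeff_zero_bracket b)
      (h := 0 + C b * X ^ 1) (by simp) (n := 2) ?_) 1 one_lt_two
    · rw [map_sub, c0, subst_zero_of_constantCoeff_zero (by simpa using Φ.coeff_zero_bracket a),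
        map_zero, zero_add, coeff_one_bracket, sub_eq_zero] at this
      exact this
    · rw [X_pow_dvd_iff]
      intro m hm
      have hb0 := Φ.coeff_zero_bracket b
      rw [coeff_zero_eq_constantCoeff_apply] at hb0
      interval_cases m <;> simp [hb0, coeff_one_bracket]
  refine Φ.bracket_unique (Φ.coeff_zero_bracket _) h0 ?_ (Φ.subst_bracket _) ?_
  · rw [coeff_one_bracket, h1]
  · rw [← subst_comp_subst_apply ha hb, subst_bracket, subst_comp_subst_apply hΦ hb,
      subst_bracket, subst_comp_subst_apply hb hΦ]

end LubinTateSeries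

/-! ### The rings `A[[t_•]]`, `A((t_•))` -/

section LaurentRing

variable (D : Type*) [Fintype D] (A : Type*) [CommRing A]

/-- The ring `A((t_•)) = A[[t_d]]_{d ∈ D}[∏_d t_d⁻¹]`. -/
abbrev LaurentRing : Type _ :=
  Localization.Away (∏ d : D, (MvPowerSeries.X d : MvPowerSeries D A))

variable {D A}

theorem isUnit_algebraMap_X (d : D) :
    IsUnit (algebraMap (MvPowerSeries D A) (LaurentRing D A) (MvPowerSeries.X d)) := by
  have h := IsLocalization.Away.algebraMap_isUnit (S := LaurentRing D A)
    (∏ d : D, (MvPowerSeries.X d : MvPowerSeries D A))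
  rw [map_prod] at h
  exact (IsUnit.prod_univ_iff.mp h) d

/-- The ring homomorphism `A((t_•)) → B((t_•))` obtained by applying `A → B` to the coefficients. -/
def LaurentRing.map {B : Type*} [CommRing B] (f : A →+* B) : LaurentRing D A →+* LaurentRing D B :=
  IsLocalization.Away.lift (∏ d : D, (MvPowerSeries.X d : MvPowerSeries D A))
    (g := (algebraMap (MvPowerSeries D B) (LaurentRing D B)).comp (MvPowerSeries.map f)) (by
      rw [map_prod]
      refine IsUnit.prod_univ_iff.mpr fun d => ?_
      rw [RingHom.comp_apply, MvPowerSeries.map_X]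
      exact isUnit_algebraMap_X d)

end LaurentRing

namespace LubinTateSeries

variable {O : Type*} [CommRing O] [IsDomain O] [IsDiscreteValuationRing O]
  [Finite (IsLocalRing.ResidueField O)] (Φ : LubinTateSeries O)
  (D : Type*) [Fintype D] (A : Type*) [CommRing A] [Algebra O A]

variable {D}

/-- The image in `A[[t_•]]` of the power series `[γ_d]_Φ(t_d)`, for `γ = (γ_d)_d ∈ Γ_•`. -/
def shift (γ : D → Oˣ) (d : D) : MvPowerSeries D A :=
  (Φ.bracket (γ d : O)).subst (MvPowerSeries.X d : MvPowerSeries D A)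

theorem exists_shift_eq (γ : D → Oˣ) (d : D) :
    ∃ u : MvPowerSeries D A, IsUnit u ∧ Φ.shift A γ d = MvPowerSeries.X d * u := by
  obtain ⟨r, hr⟩ : X ∣ Φ.bracket (γ d : O) := by
    rw [X_dvd_iff, ← coeff_zero_eq_constantCoeff_apply, coeff_zero_bracket]
  have hX : HasSubst (MvPowerSeries.X d : MvPowerSeries D A) := .X d
  have hr0 : coeff 0 r = γ d := by
    rw [← Φ.coeff_one_bracket (γ d), hr, coeff_succ_X_mul 0 r]
  refine ⟨r.subst (MvPowerSeries.X d : MvPowerSeries D A), ?_, ?_⟩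
  · rw [← coe_substAlgHom hX]
    refine IsUnit.map _ ?_
    rw [PowerSeries.isUnit_iff_constantCoeff, ← coeff_zero_eq_constantCoeff_apply, hr0]
    exact (γ d).isUnit
  · rw [shift, hr, subst_mul hX, subst_X hX]

theorem hasSubst_shift (γ : D → Oˣ) : MvPowerSeries.HasSubst (Φ.shift A γ) :=
  MvPowerSeries.hasSubst_of_constantCoeff_zero fun d => by
    obtain ⟨u, -, hu⟩ := Φ.exists_shift_eq A γ d
    rw [hu, map_mul, MvPowerSeries.constantCoeff_X, zero_mul]

/-- The action of `γ ∈ Γ_•` on `A[[t_•]]`: the substitution `t_d ↦ [γ_d]_Φ(t_d)`. -/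
def actSeries (γ : D → Oˣ) : MvPowerSeries D A →ₐ[A] MvPowerSeries D A :=
  MvPowerSeries.substAlgHom (Φ.hasSubst_shift A γ)

theorem actSeries_X (γ : D → Oˣ) (d : D) :
    Φ.actSeries A γ (MvPowerSeries.X d) = Φ.shift A γ d :=
  MvPowerSeries.substAlgHom_X _ d

theorem actSeries_one (f : MvPowerSeries D A) : Φ.actSeries A 1 f = f := by
  have : Φ.shift A (1 : D → Oˣ) = MvPowerSeries.X := by
    funext d
    rw [shift, Pi.one_apply, Units.val_one, bracket_one, subst_X (.X d)]
  rw [actSeries, MvPowerSeries.substAlgHom_apply, this, MvPowerSeries.subst_self, id]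

theorem actSeries_mul (γ δ : D → Oˣ) (f : MvPowerSeries D A) :
    Φ.actSeries A (γ * δ) f = Φ.actSeries A γ (Φ.actSeries A δ f) := by
  simp only [actSeries, MvPowerSeries.substAlgHom_apply]
  rw [MvPowerSeries.subst_comp_subst_apply (Φ.hasSubst_shift A δ) (Φ.hasSubst_shift A γ)]
  congr 1
  funext d
  have hX : HasSubst (MvPowerSeries.X d : MvPowerSeries D A) := .X d
  have h1 : MvPowerSeries.subst (Φ.shift A γ) (Φ.shift A δ d) =
      (Φ.bracket (δ d : O)).subst (Φ.shift A γ d) := by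
    rw [shift, PowerSeries.subst, MvPowerSeries.subst_comp_subst_apply hX.const
      (Φ.hasSubst_shift A γ), MvPowerSeries.subst_X (Φ.hasSubst_shift A γ)]
    rfl
  rw [h1, shift, shift, Pi.mul_apply, Units.val_mul, mul_comm, bracket_mul,
    subst_comp_subst_apply (Φ.hasSubst_bracket _) hX]

/-- The action of `γ = (γ_d)_d ∈ Γ_•` on `A((t_•))`: the `A`-algebra endomorphism extending the
substitution `t_d ↦ [γ_d]_Φ(t_d)` on `A[[t_•]]`. -/
def act (γ : D → Oˣ) : LaurentRing D A →+* LaurentRing D A :=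
  IsLocalization.Away.lift (∏ d : D, (MvPowerSeries.X d : MvPowerSeries D A))
    (g := (algebraMap (MvPowerSeries D A) (LaurentRing D A)).comp
      (Φ.actSeries A γ).toRingHom) (by
        rw [map_prod]
        refine IsUnit.prod_univ_iff.mpr fun d => ?_
        obtain ⟨u, hu, h⟩ := Φ.exists_shift_eq A γ d
        change IsUnit (algebraMap _ _ (Φ.actSeries A γ (MvPowerSeries.X d)))
        rw [actSeries_X, h, map_mul]
        exact (isUnit_algebraMap_X d).mul (hu.map _))

theorem act_algebraMap (γ : D → Oˣ) (f : MvPowerSeries D A) :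
    Φ.act A γ (algebraMap _ (LaurentRing D A) f) = algebraMap _ _ (Φ.actSeries A γ f) :=
  IsLocalization.Away.lift_eq _ _ f

theorem act_one (x : LaurentRing D A) : Φ.act A 1 x = x := by
  refine congrFun (congrArg DFunLike.coe (?_ : Φ.act A (1 : D → Oˣ) = RingHom.id _)) x
  refine IsLocalization.ringHom_ext
    (Submonoid.powers (∏ d : D, (MvPowerSeries.X d : MvPowerSeries D A))) (RingHom.ext fun f => ?_)
  simp only [RingHom.comp_apply, act_algebraMap, actSeries_one, RingHom.id_apply]

theorem act_mul (γ δ : D → Oˣ) (x : LaurentRing D A) :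
    Φ.act A (γ * δ) x = Φ.act A γ (Φ.act A δ x) := by
  refine congrFun (congrArg DFunLike.coe
    (?_ : Φ.act A (γ * δ) = (Φ.act A γ).comp (Φ.act A δ))) x
  refine IsLocalization.ringHom_ext
    (Submonoid.powers (∏ d : D, (MvPowerSeries.X d : MvPowerSeries D A))) (RingHom.ext fun f => ?_)
  simp only [RingHom.comp_apply, act_algebraMap, actSeries_mul]

variable (D)

/-- The action of `Γ_• = ∏_{d ∈ D} O^×` on `A((t_•))` by ring automorphisms attached to `Φ`. -/
@[reducible] def mulSemiringAction : MulSemiringAction (D → Oˣ) (LaurentRing D A) where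
  smul γ x := Φ.act A γ x
  one_smul := Φ.act_one A
  mul_smul := Φ.act_mul A
  smul_zero γ := map_zero (Φ.act A γ)
  smul_add γ := map_add (Φ.act A γ)
  smul_one γ := map_one (Φ.act A γ)
  smul_mul γ := map_mul (Φ.act A γ)

/-- The `A`-algebra `A((t_•))[Γ_•]`: the skew group ring of `Γ_•` over
`A((t_•))`, for the action `Φ.mulSemiringAction D A`. Its elements are the finite formal sums
`∑ x_γ · γ`, and they are multiplied by the rule `γ · x = (γ * x) · γ`. -/
def SkewGroupRing (_ : LubinTateSeries O) (D : Type*) [Fintype D] (A : Type*) [CommRing A] :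
    Type _ :=
  SkewMonoidAlgebra (LaurentRing D A) (D → Oˣ)

instance : Ring (Φ.SkewGroupRing D A) :=
  letI := Φ.mulSemiringAction D A
  SkewMonoidAlgebra.instRing

/-- The inclusion `A((t_•)) → A((t_•))[Γ_•]`. -/
def ofLaurent : LaurentRing D A →+* Φ.SkewGroupRing D A :=
  letI := Φ.mulSemiringAction D A
  SkewMonoidAlgebra.singleOneRingHom

/-- The inclusion `Γ_• → A((t_•))[Γ_•]`. -/
def ofGroup : (D → Oˣ) →* Φ.SkewGroupRing D A :=
  letI := Φ.mulSemiringAction D A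
  SkewMonoidAlgebra.of (LaurentRing D A) (D → Oˣ)

/-- The commutation rule `γ · x = (γ * x) · γ` in `A((t_•))[Γ_•]`. -/
theorem ofGroup_mul_ofLaurent (γ : D → Oˣ) (x : LaurentRing D A) :
    Φ.ofGroup D A γ * Φ.ofLaurent D A x = Φ.ofLaurent D A (Φ.act A γ x) * Φ.ofGroup D A γ := by
  let := Φ.mulSemiringAction D A
  refine (SkewMonoidAlgebra.single_mul_single (a₁ := γ) (a₂ := 1) (b₁ := 1) (b₂ := x)).trans
    (Eq.trans ?_ (SkewMonoidAlgebra.single_mul_single (a₁ := 1) (a₂ := γ) (b₁ := γ • x)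
      (b₂ := (1 : LaurentRing D A))).symm)
  simp

end LubinTateSeries

end LubinTate

end

/-! ### Power series modulo a constant -/

namespace LubinTate

open PowerSeries

/-! The elements of `A((t_•))` killing `𝐃'` form an ideal, and the commutation rule makes it
`Γ_•`-stable. The claim is therefore about ideals: a stable ideal with nonzero image in `k((t_•))`
contains 1. Since `A → k` has nilpotent kernel, a lift of 1 from the image differs from 1 by a
nilpotent, so it is enough to treat `k((t_•))` (`eq_top_of_map_ne_zero`).

Over `k`, contract the ideal to `J ⊆ k[[t_•]]`, which is saturated with respect to each variable.
Take `f ∈ J` and expand it as `∑ f_a t_d ^ a`, with each `f_a` free of `t_d`. Group elements moving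
only `t_d` give `∑ f_a x_i ^ a ∈ J` for infinitely many nodes `x_i = [γ_i]_Φ(t_d)`. Differences of
nodes are powers of `t_d` times units, so divided differences can be formed inside `J`. As all nodes
vanish modulo `t_d`, this isolates each `f_n` modulo `t_d` (`exists_coeff_add_mul_mem`,
`exists_slice_add_mem`). Doing so for one variable after another turns any coefficient of `f` into
the constant term of an element of `J` (`exists_mem_coeff_eq`); a nonzero one gives a unit.

The nodes are distinct because `[a]_Φ` is determined by its reduction modulo the uniformizer
(`map_bracket_injective`), which is a rigidity property of series commuting with `Φ`. -/

theorem C_dvd_iff {R : Type*} [CommRing R] (a : R) (f : R⟦X⟧) :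
    C a ∣ f ↔ ∀ n, a ∣ coeff n f := by
  constructor
  · rintro ⟨g, rfl⟩ n
    exact ⟨coeff n g, coeff_C_mul n g a⟩
  · intro h
    choose g hg using h
    exact ⟨PowerSeries.mk g, by ext n; rw [coeff_C_mul, coeff_mk, hg]⟩

theorem C_dvd_iff_map_mk {R : Type*} [CommRing R] (a : R) (f : R⟦X⟧) :
    C a ∣ f ↔ PowerSeries.map (Ideal.Quotient.mk (Ideal.span {a})) f = 0 := by
  simp only [C_dvd_iff, PowerSeries.ext_iff, coeff_map, map_zero, Ideal.Quotient.eq_zero_iff_mem,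
    Ideal.mem_span_singleton]

/-- Substitution commutes with reducing coefficients modulo `a`. -/
theorem C_dvd_subst_sub {R : Type*} [CommRing R] {a : R} (f : R⟦X⟧) {g h : R⟦X⟧}
    (hg : HasSubst g) (hh : HasSubst h) (hd : C a ∣ g - h) :
    C a ∣ f.subst g - f.subst h := by
  rw [C_dvd_iff_map_mk, map_sub, sub_eq_zero] at hd ⊢
  have e1 := PowerSeries.map_subst hg (h := Ideal.Quotient.mk (Ideal.span {a})) f
  have e2 := PowerSeries.map_subst hh (h := Ideal.Quotient.mk (Ideal.span {a})) f
  refine e1.trans (Eq.trans ?_ e2.symm)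
  congr 1

/-- Substitution into a power series with coefficients in `R` factors through the images of the
coefficients. -/
theorem subst_map_algebraMap {R S τ : Type*} [CommRing R] [CommRing S] [Algebra R S]
    {a : MvPowerSeries τ S} (ha : HasSubst a) (f : R⟦X⟧) :
    (PowerSeries.map (algebraMap R S) f).subst a = f.subst a := by
  rw [map_algebraMap_eq_subst_X, subst_comp_subst_apply (HasSubst.X' (R := S)) ha, subst_X ha]

/-! ### Rigidity of series commuting with `Φ` -/

namespace LubinTateSeries

variable {O : Type*} [CommRing O] [IsDomain O] [IsDiscreteValuationRing O]
  (Φ : LubinTateSeries O)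

theorem C_uniformizer_dvd_iff (f : O⟦X⟧) :
    C Φ.uniformizer ∣ f ↔ PowerSeries.map (IsLocalRing.residue O) f = 0 := by
  simp only [C_dvd_iff, PowerSeries.ext_iff, coeff_map, map_zero, Φ.uniformizer_dvd_iff]

/-- The units `1 - π ^ (n + 1)` are pairwise distinct. This ensures that there are enough
interpolation nodes. -/
theorem infinite_units (Φ : LubinTateSeries O) : Infinite Oˣ := by
  have h (n : ℕ) : IsUnit (1 - Φ.uniformizer ^ (n + 1)) := by
    rw [← neg_sub, IsUnit.neg_iff]
    exact Φ.isUnit_pow_sub_one (by omega)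
  refine Infinite.of_injective (fun n : ℕ => (h n).unit) fun m n hmn => ?_
  have := congrArg Units.val hmn
  simp only [IsUnit.unit_spec, sub_right_inj] at this
  have := pow_injective_of_not_isUnit Φ.irreducible.not_isUnit Φ.irreducible.ne_zero this
  omega

variable [Finite (IsLocalRing.ResidueField O)]

theorem uniformizer_dvd_natCard :
    Φ.uniformizer ∣ (Nat.card (IsLocalRing.ResidueField O) : O) := by
  have := Fintype.ofFinite (IsLocalRing.ResidueField O)
  rw [uniformizer_dvd_iff, map_natCast, Nat.card_eq_fintype_card, Nat.cast_card_eq_zero]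

/-- Over the residue field `Φ` becomes `t ^ q`, and `f(t ^ q) = f ^ q` there; power series over a
field have no nilpotents. -/
theorem C_uniformizer_dvd_of_dvd_subst {f : O⟦X⟧} (h : C Φ.uniformizer ∣ f.subst Φ.series) :
    C Φ.uniformizer ∣ f := by
  rw [C_uniformizer_dvd_iff] at h ⊢
  have hq : Nat.card (IsLocalRing.ResidueField O) ≠ 0 := Nat.card_pos.ne'
  have hΦ : PowerSeries.map (IsLocalRing.residue O) Φ.series =
      X ^ Nat.card (IsLocalRing.ResidueField O) := by
    have := (Φ.C_uniformizer_dvd_iff _).mp ((C_dvd_iff _ _).mpr Φ.frobenius)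
    rwa [map_sub, map_pow, map_X, sub_eq_zero] at this
  have e : PowerSeries.map (IsLocalRing.residue O) (f.subst Φ.series) =
      (PowerSeries.map (IsLocalRing.residue O) f).subst
        (PowerSeries.map (IsLocalRing.residue O) Φ.series) :=
    PowerSeries.map_subst Φ.hasSubst_series _
  rw [e, hΦ, ← pow_card_eq_subst] at h
  exact eq_zero_of_pow_eq_zero h

/-- Write `g - h = π ^ j δ`. Because `Φ ≡ t ^ q` and `q ≡ 0` modulo `π`, applying `Φ` on the outside
gains a factor `π`. Commutation turns this into `π ^ (j + 1) ∣ π ^ j δ(Φ)`, whence `π ∣ δ`. -/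
theorem C_pow_succ_dvd_sub {g h : O⟦X⟧} (hg' : HasSubst g) (hh' : HasSubst h)
    (hg : Φ.series.subst g = g.subst Φ.series) (hh : Φ.series.subst h = h.subst Φ.series)
    {j : ℕ} (hj : 1 ≤ j) (hd : C Φ.uniformizer ^ j ∣ g - h) :
    C Φ.uniformizer ^ (j + 1) ∣ g - h := by
  set q := Nat.card (IsLocalRing.ResidueField O)
  obtain ⟨Ψ, hΨ⟩ := (C_dvd_iff _ _).mpr Φ.frobenius
  have key : ∀ k : O⟦X⟧, HasSubst k →
      Φ.series.subst k = k ^ q + C Φ.uniformizer * Ψ.subst k := by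
    intro k hk
    rw [sub_eq_iff_eq_add'.mp hΨ, subst_add hk, subst_mul hk, subst_pow hk, subst_X hk, subst_C]
    rfl
  have h1 : C Φ.uniformizer ^ (j + 1) ∣ Φ.series.subst g - Φ.series.subst h := by
    have hd' := hd
    rw [← map_pow] at hd'
    obtain ⟨ε, hε⟩ := C_dvd_subst_sub Ψ hg' hh' hd'
    obtain ⟨δ, hδ⟩ := hd
    obtain ⟨r, hr⟩ := Polynomial.powAddExpansion h (C Φ.uniformizer ^ j * δ) q
    obtain ⟨c, hc⟩ := Φ.uniformizer_dvd_natCard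
    have hc' : (q : O⟦X⟧) = C Φ.uniformizer * C c := by
      rw [← map_mul, ← hc, map_natCast]
    obtain ⟨i, rfl⟩ := Nat.exists_eq_add_of_le' hj
    rw [← hδ, add_sub_cancel] at hr
    rw [map_pow] at hε
    -- The three terms come from the linear part of the binomial expansion (where `q = π c`), its
    -- quadratic remainder (`2 j ≥ j + 1`, as `1 ≤ j`), and the part `π Ψ` of `Φ`.
    refine ⟨C c * h ^ (q - 1) * δ + C Φ.uniformizer ^ i * r * δ ^ 2 + ε, ?_⟩
    rw [key g hg', key h hh', hr, hc', hδ]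
    linear_combination C Φ.uniformizer * hε
  obtain ⟨δ, hδ⟩ := hd
  have hC : C Φ.uniformizer ≠ 0 := by
    rw [Ne, ← map_zero (C : O →+* O⟦X⟧), (C_injective).eq_iff]
    exact Φ.irreducible.ne_zero
  have hs : (C Φ.uniformizer : O⟦X⟧).subst Φ.series = C Φ.uniformizer := subst_C _
  rw [hg, hh, ← subst_sub Φ.hasSubst_series, hδ, subst_mul Φ.hasSubst_series,
    subst_pow Φ.hasSubst_series, hs, pow_succ] at h1
  have h2 := (mul_dvd_mul_iff_left (pow_ne_zero j hC)).mp h1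
  rw [hδ, pow_succ]
  exact mul_dvd_mul_left _ (Φ.C_uniformizer_dvd_of_dvd_subst h2)

/-- Power series commuting with `Φ` are determined by their reduction modulo the uniformizer. -/
theorem eq_of_C_uniformizer_dvd_sub {g h : O⟦X⟧} (hg' : HasSubst g) (hh' : HasSubst h)
    (hg : Φ.series.subst g = g.subst Φ.series) (hh : Φ.series.subst h = h.subst Φ.series)
    (hd : C Φ.uniformizer ∣ g - h) : g = h := by
  have hj : ∀ j, C Φ.uniformizer ^ (j + 1) ∣ g - h := by
    intro j
    induction j with
    | zero => simpa using hd
    | succ j ih => exact Φ.C_pow_succ_dvd_sub hg' hh' hg hh (by omega) ih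
  ext n
  rw [← sub_eq_zero, ← map_sub]
  by_contra hn
  obtain ⟨m, hm⟩ := FiniteMultiplicity.of_not_isUnit Φ.irreducible.not_isUnit hn
  refine hm ?_
  have := hj m
  rw [← map_pow, C_dvd_iff] at this
  exact this n

/-- The reduction of `[a]_Φ` to a field depends injectively on `a`. -/
theorem map_bracket_injective {k : Type*} [Field k] (f : O →+* k) :
    Function.Injective fun a => PowerSeries.map f (Φ.bracket a) := by
  intro a b hab
  have hd : C Φ.uniformizer ∣ Φ.bracket a - Φ.bracket b := by
    rw [C_dvd_iff]
    intro n
    rw [uniformizer_dvd_iff, IsLocalRing.residue_eq_zero_iff, IsLocalRing.mem_maximalIdeal,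
      mem_nonunits_iff]
    -- It is not needed that `f` kills the uniformizer: a unit coefficient of the difference would
    -- have nonzero image in `k`.
    intro hu
    have h1 := congrArg (coeff n) hab
    simp only [coeff_map] at h1
    exact (hu.map f).ne_zero (by rw [map_sub, map_sub, h1, sub_self])
  have := Φ.eq_of_C_uniformizer_dvd_sub (Φ.hasSubst_bracket a) (Φ.hasSubst_bracket b)
    (Φ.subst_bracket a) (Φ.subst_bracket b) hd
  rw [← Φ.coeff_one_bracket a, this, coeff_one_bracket]

/-- The difference is a nonzero one-variable series over a field, hence a power of the variable
times a unit. -/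
theorem exists_shift_sub_shift_eq {D k : Type*} [Field k] [Algebra O k] {γ γ' : D → Oˣ} {d : D}
    (hγ : γ d ≠ γ' d) : ∃ (e : ℕ) (u : MvPowerSeries D k), IsUnit u ∧
      Φ.shift k γ d - Φ.shift k γ' d = MvPowerSeries.X d ^ e * u := by
  have hX : HasSubst (MvPowerSeries.X d : MvPowerSeries D k) := .X d
  set g := PowerSeries.map (algebraMap O k) (Φ.bracket (γ d)) -
    PowerSeries.map (algebraMap O k) (Φ.bracket (γ' d)) with hg
  have hg0 : g ≠ 0 := fun h0 => hγ (Units.ext (Φ.map_bracket_injective _ (sub_eq_zero.mp h0)))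
  obtain ⟨n, u, hu⟩ := IsDiscreteValuationRing.associated_pow_irreducible hg0
    PowerSeries.X_irreducible
  refine ⟨n, (↑u⁻¹ : k⟦X⟧).subst (MvPowerSeries.X d : MvPowerSeries D k), ?_, ?_⟩
  · rw [← coe_substAlgHom hX]
    exact u⁻¹.isUnit.map _
  · rw [shift, shift, ← subst_map_algebraMap hX (Φ.bracket (γ d)),
      ← subst_map_algebraMap hX (Φ.bracket (γ' d)), ← subst_sub hX, ← hg,
      (Units.eq_mul_inv_iff_mul_eq u).mpr hu, subst_mul hX, subst_pow hX, subst_X hX]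

end LubinTateSeries

/-! ### Interpolation modulo a saturated ideal -/

/-- Divided differences: if an ideal `J`, saturated with respect to `t`, contains approximations of
the values of a polynomial `P` at sufficiently many nodes, then it contains an element congruent to
a coefficient of `P` modulo `t`. -/
theorem exists_coeff_add_mul_mem {R : Type*} [CommRing R] {J : Ideal R} {t : R}
    (hJ : ∀ x, t * x ∈ J → x ∈ J) (n : ℕ) (x : ℕ → R) (hx : ∀ i, t ∣ x i)
    (hxx : ∀ i j, i ≠ j → ∃ (e : ℕ) (u : R), IsUnit u ∧ x i - x j = t ^ e * u) :
    ∃ M : ℕ, ∀ P : Polynomial R, (∀ i ≤ n, ∃ s, P.eval (x i) + t ^ M * s ∈ J) →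
      ∃ s, P.coeff n + t * s ∈ J := by
  have hJ' : ∀ (e : ℕ) (u y : R), IsUnit u → t ^ e * u * y ∈ J → y ∈ J := by
    intro e u y hu h
    induction e with
    | zero => rwa [pow_zero, one_mul, Ideal.unit_mul_mem_iff_mem _ hu] at h
    | succ e ih => exact ih (hJ _ (by rwa [pow_succ', mul_assoc, mul_assoc, ← mul_assoc _ u] at h))
  induction n generalizing x with
  | zero =>
    refine ⟨1, fun P hP => ?_⟩
    obtain ⟨s, hs⟩ := hP 0 le_rfl
    obtain ⟨y, hy⟩ := hx 0
    obtain ⟨r, hr⟩ := P.sub_dvd_eval_sub (x 0) 0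
    refine ⟨y * r + s, ?_⟩
    rw [Polynomial.coeff_zero_eq_eval_zero]
    convert hs using 1
    rw [hy] at hr ⊢
    linear_combination -hr
  | succ n ih =>
    obtain ⟨M, hM⟩ := ih (fun i => x (i + 1)) (fun i => hx _)
      fun i j hij => hxx _ _ (by omega)
    choose e u hu hxe using fun i : ℕ => hxx (i + 1) 0 (by omega)
    -- Passing to the divided difference at node `i + 1` costs `t ^ e i`; the sum pays for any one
    -- of these divisions.
    refine ⟨M + ∑ i ∈ Finset.range (n + 1), e i, fun P hP => ?_⟩
    set Q := P /ₘ (Polynomial.X - Polynomial.C (x 0))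
    have hQ : P = Polynomial.C (P.eval (x 0)) + (Polynomial.X - Polynomial.C (x 0)) * Q := by
      rw [← Polynomial.modByMonic_X_sub_C_eq_C_eval, Polynomial.modByMonic_add_div]
    obtain ⟨s₀, h₀⟩ := hP 0 (Nat.zero_le _)
    have hQJ : ∀ i ≤ n, ∃ s, Q.eval (x (i + 1)) + t ^ M * s ∈ J := by
      intro i hi
      obtain ⟨s, hs⟩ := hP (i + 1) (by omega)
      obtain ⟨E, hE⟩ := Nat.exists_eq_add_of_le (Finset.single_le_sum (f := e)
        (fun _ _ => Nat.zero_le _) (Finset.mem_range.mpr (Nat.lt_succ_of_le hi)))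
      obtain ⟨v, hv⟩ := (hu i).exists_right_inv
      -- `Q(x_{i+1})` is `P(x_{i+1}) - P(x_0)` divided by `t ^ e i * u i`; saturation allows this
      -- division inside `J`, and `v` inverts `u i` in the error term.
      refine ⟨t ^ E * (v * (s - s₀)), hJ' (e i) (u i) _ (hu i) ?_⟩
      have h1 := congrArg (Polynomial.eval (x (i + 1))) hQ
      simp only [Polynomial.eval_add, Polynomial.eval_C, Polynomial.eval_mul, Polynomial.eval_sub,
        Polynomial.eval_X] at h1
      convert J.sub_mem hs h₀ using 1
      rw [h1, hE, hxe i, pow_add, pow_add]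
      linear_combination t ^ M * t ^ e i * t ^ E * (s - s₀) * hv
    obtain ⟨s, hs⟩ := hM Q hQJ
    obtain ⟨y, hy⟩ := hx 0
    -- `P.coeff (n + 1) = Q.coeff n - x 0 * Q.coeff (n + 1)`, and `x 0 = t * y` puts the last term
    -- into the error.
    refine ⟨s + y * Q.coeff (n + 1), ?_⟩
    convert hs using 1
    have h1 := congrArg (fun p => Polynomial.coeff p (n + 1)) hQ
    simp only [Polynomial.coeff_add, Polynomial.coeff_C_succ, sub_mul, Polynomial.coeff_sub,
      Polynomial.coeff_X_mul, Polynomial.coeff_C_mul] at h1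
    rw [h1, hy]
    ring

/-! ### Expansion in a single variable -/

section Slice

variable {D R : Type*} [CommRing R]

open scoped Classical in
/-- The coefficient of `t_d ^ n` in a power series `f`, as a power series not involving `t_d`. -/
noncomputable def slice (d : D) (n : ℕ) (f : MvPowerSeries D R) : MvPowerSeries D R :=
  fun e => if e d = 0 then MvPowerSeries.coeff (e + Finsupp.single d n) f else 0

theorem coeff_slice_of_eq_zero {d : D} (n : ℕ) (f : MvPowerSeries D R) {e : D →₀ ℕ}
    (he : e d = 0) :
    MvPowerSeries.coeff e (slice d n f) = MvPowerSeries.coeff (e + Finsupp.single d n) f :=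
  if_pos he

theorem coeff_slice_of_ne_zero {d : D} (n : ℕ) (f : MvPowerSeries D R) {e : D →₀ ℕ}
    (he : e d ≠ 0) : MvPowerSeries.coeff e (slice d n f) = 0 :=
  if_neg he

theorem X_pow_dvd_sub_sum_slice (d : D) (N : ℕ) (f : MvPowerSeries D R) :
    MvPowerSeries.X d ^ N ∣
      f - ∑ a ∈ Finset.range N, slice d a f * MvPowerSeries.X d ^ a := by
  classical
  rw [MvPowerSeries.X_pow_dvd_iff]
  intro m hm
  have hle : ∀ a, Finsupp.single d a ≤ m ↔ a ≤ m d := fun a => Finsupp.single_le_iff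
  rw [map_sub, map_sum, Finset.sum_eq_single_of_mem (m d) (Finset.mem_range.mpr hm)]
  · rw [MvPowerSeries.X_pow_eq, MvPowerSeries.coeff_mul_monomial, if_pos ((hle _).mpr le_rfl),
      mul_one, coeff_slice_of_eq_zero _ _ (by simp), tsub_add_cancel_of_le ((hle _).mpr le_rfl),
      sub_self]
  · intro a _ ha
    rw [MvPowerSeries.X_pow_eq, MvPowerSeries.coeff_mul_monomial]
    split_ifs with h
    · rw [coeff_slice_of_ne_zero, zero_mul]
      have := (hle a).mp h
      simp only [Finsupp.coe_tsub, Pi.sub_apply, Finsupp.single_eq_same]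
      omega
    · rfl

/-- Monomials occurring in a slice do not involve `t_d`, the only variable that `a` moves. -/
theorem subst_slice [Finite D] {d : D} {a : D → MvPowerSeries D R} (ha : MvPowerSeries.HasSubst a)
    (had : ∀ d', d' ≠ d → a d' = MvPowerSeries.X d') (n : ℕ) (f : MvPowerSeries D R) :
    MvPowerSeries.subst a (slice d n f) = slice d n f := by
  have hX : MvPowerSeries.HasSubst (MvPowerSeries.X : D → MvPowerSeries D R) :=
    MvPowerSeries.HasSubst.X
  conv_rhs => rw [← id_eq (slice d n f), ← MvPowerSeries.subst_self]
  ext m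
  rw [MvPowerSeries.coeff_subst ha, MvPowerSeries.coeff_subst hX]
  refine finsum_congr fun e => ?_
  by_cases he : e d = 0
  · congr 2
    refine Finsupp.prod_congr fun d' hd' => ?_
    rw [had d']
    rintro rfl
    exact (Finsupp.mem_support_iff.mp hd') he
  · rw [coeff_slice_of_ne_zero _ _ he, zero_smul, zero_smul]

end Slice

/-! ### Stable saturated ideals of `k[[t_•]]` -/

namespace LubinTateSeries

variable {O : Type*} [CommRing O] [IsDomain O] [IsDiscreteValuationRing O]
  [Finite (IsLocalRing.ResidueField O)] (Φ : LubinTateSeries O)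
  {D : Type*} [Fintype D] {k : Type*} [Field k] [Algebra O k]
  {J : Ideal (MvPowerSeries D k)}

theorem exists_slice_add_mem
    (hsat : ∀ d f, MvPowerSeries.X d * f ∈ J → f ∈ J)
    (hact : ∀ γ, ∀ f ∈ J, Φ.actSeries k γ f ∈ J)
    (d : D) (n : ℕ) {f : MvPowerSeries D k} (hf : f ∈ J) :
    ∃ s, slice d n f + MvPowerSeries.X d * s ∈ J := by
  classical
  have := Φ.infinite_units
  let γ (i : ℕ) : D → Oˣ := Function.update 1 d (Infinite.natEmbedding Oˣ i)
  let x (i : ℕ) : MvPowerSeries D k := Φ.shift k (γ i) d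
  choose u hu hxu using fun i => Φ.exists_shift_eq k (γ i) d
  obtain ⟨M, hM⟩ := exists_coeff_add_mul_mem (hsat d) n x (fun i => ⟨u i, hxu i⟩) fun i j hij =>
    Φ.exists_shift_sub_shift_eq (by simpa [γ] using hij)
  -- The bound `M` does not depend on the polynomial, so the truncation degree may be chosen after
  -- it: `N ≥ M` makes the tail an admissible error, and `N > n` keeps the slice of index `n`.
  set N := M + (n + 1)
  obtain ⟨r, hr⟩ := X_pow_dvd_sub_sum_slice d N f
  let P : Polynomial (MvPowerSeries D k) :=
    ∑ a ∈ Finset.range N, Polynomial.monomial a (slice d a f)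
  have hP : P.coeff n = slice d n f := by
    rw [Polynomial.finsetSum_coeff, Finset.sum_eq_single_of_mem n (Finset.mem_range.mpr (by omega)),
      Polynomial.coeff_monomial_same]
    exact fun a _ ha => Polynomial.coeff_monomial_of_ne _ ha.symm
  rw [← hP]
  refine hM P fun i _ => ?_
  have hs : ∀ a, Φ.actSeries k (γ i) (slice d a f) = slice d a f := by
    intro a
    rw [actSeries, MvPowerSeries.substAlgHom_apply]
    refine subst_slice (Φ.hasSubst_shift k (γ i)) (fun d' hd' => ?_) a f
    have hγ : γ i d' = 1 := Function.update_of_ne hd' _ _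
    rw [shift, hγ, Units.val_one, bracket_one, subst_X (.X d')]
  -- This is the transformed tail `x i ^ N * γ_i(r)`, with `x i = t_d * u i` and `t_d ^ M` split
  -- off.
  refine ⟨MvPowerSeries.X d ^ (n + 1) * u i ^ N * Φ.actSeries k (γ i) r, ?_⟩
  convert hact (γ i) f hf using 1
  rw [sub_eq_iff_eq_add'.mp hr, map_add, map_mul, map_pow, map_sum, actSeries_X,
    Polynomial.eval_finsetSum]
  congr 1
  · refine Finset.sum_congr rfl fun a _ => ?_
    rw [Polynomial.eval_monomial, map_mul, map_pow, actSeries_X, hs]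
  · rw [hxu i, mul_pow, pow_add]
    ring

/-- Induction on the support of `e`: passing to a slice removes one variable from the exponent, and
the error divisible by `t_d` does not affect coefficients whose exponent is 0 at `d`. -/
theorem exists_mem_coeff_eq
    (hsat : ∀ d f, MvPowerSeries.X d * f ∈ J → f ∈ J)
    (hact : ∀ γ, ∀ f ∈ J, Φ.actSeries k γ f ∈ J)
    (e : D →₀ ℕ) {f : MvPowerSeries D k} (hf : f ∈ J) :
    ∃ g ∈ J, MvPowerSeries.coeff 0 g = MvPowerSeries.coeff e f := by
  induction e using Finsupp.induction generalizing f with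
  | zero => exact ⟨f, hf, rfl⟩
  | single_add d n e hd hn ih =>
    obtain ⟨s, hs⟩ := Φ.exists_slice_add_mem hsat hact d n hf
    obtain ⟨g, hg, h⟩ := ih hs
    refine ⟨g, hg, h.trans ?_⟩
    have hd' : e d = 0 := Finsupp.notMem_support_iff.mp hd
    rw [map_add, coeff_slice_of_eq_zero _ _ hd', MvPowerSeries.X_dvd_iff.mp ⟨s, rfl⟩ e hd',
      add_zero, add_comm]

/-- A nonzero ideal of `k[[t_•]]` which is stable under `Γ_•` and saturated with respect to the
variables is the unit ideal. -/
theorem eq_top_of_stable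
    (hsat : ∀ d f, MvPowerSeries.X d * f ∈ J → f ∈ J)
    (hact : ∀ γ, ∀ f ∈ J, Φ.actSeries k γ f ∈ J)
    (hJ : J ≠ ⊥) : J = ⊤ := by
  obtain ⟨f, hf, hf0⟩ := J.ne_bot_iff.mp hJ
  obtain ⟨e, he⟩ := (MvPowerSeries.ne_zero_iff_exists_coeff_ne_zero f).mp hf0
  obtain ⟨g, hg, h⟩ := Φ.exists_mem_coeff_eq hsat hact e hf
  refine J.eq_top_of_isUnit_mem hg (MvPowerSeries.isUnit_iff_constantCoeff.mpr ?_)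
  rw [← MvPowerSeries.coeff_zero_eq_constantCoeff_apply, h]
  exact he.isUnit

end LubinTateSeries

/-! ### Change of coefficients in Laurent rings -/

section NilpotentKernel

variable {D R : Type*} [CommRing R]

theorem coeff_pow_mem {I : Ideal R} {f : MvPowerSeries D R}
    (hf : ∀ e, MvPowerSeries.coeff e f ∈ I) (n : ℕ) (e : D →₀ ℕ) :
    MvPowerSeries.coeff e (f ^ n) ∈ I ^ n := by
  classical
  induction n generalizing e with
  | zero => simp
  | succ n ih =>
    rw [pow_succ, pow_succ, MvPowerSeries.coeff_mul]
    exact Ideal.sum_mem _ fun p _ => Ideal.mul_mem_mul (ih _) (hf _)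

variable [Fintype D]

theorem LaurentRing.map_algebraMap {B : Type*} [CommRing B] (φ : R →+* B)
    (f : MvPowerSeries D R) :
    LaurentRing.map φ (algebraMap _ (LaurentRing D R) f) =
      algebraMap _ _ (MvPowerSeries.map φ f) :=
  IsLocalization.Away.lift_eq _ _ f

theorem LaurentRing.exists_mul_eq (x : LaurentRing D R) :
    ∃ (u : LaurentRing D R) (f : MvPowerSeries D R), IsUnit u ∧
      x * u = algebraMap _ (LaurentRing D R) f := by
  obtain ⟨⟨f, s⟩, h⟩ := IsLocalization.surj
    (Submonoid.powers (∏ d : D, (MvPowerSeries.X d : MvPowerSeries D R))) x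
  exact ⟨_, f, IsLocalization.map_units _ s, h⟩

/-- If `φ` is a ring homomorphism with nilpotent kernel, so is `LaurentRing.map φ`. -/
theorem LaurentRing.isNilpotent_of_map_eq_zero {B : Type*} [CommRing B] (φ : R →+* B)
    (hφ : IsNilpotent (RingHom.ker φ)) {x : LaurentRing D R} (hx : LaurentRing.map φ x = 0) :
    IsNilpotent x := by
  obtain ⟨u, f, hu, h⟩ := LaurentRing.exists_mul_eq x
  obtain ⟨n, hn⟩ := hφ
  have h0 : algebraMap _ (LaurentRing D B) (MvPowerSeries.map φ f) = 0 := by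
    rw [← map_algebraMap, ← h, _root_.map_mul, hx, zero_mul]
  obtain ⟨⟨_, N, rfl⟩, hN⟩ := (IsLocalization.map_eq_zero_iff
    (Submonoid.powers (∏ d : D, (MvPowerSeries.X d : MvPowerSeries D B))) _ _).mp h0
  -- Multiplying by this power of the variables makes the reduction vanish already in the power
  -- series ring, where coefficients can be inspected.
  set m : MvPowerSeries D R := (∏ d : D, MvPowerSeries.X d) ^ N
  have hm : IsUnit (algebraMap _ (LaurentRing D R) m) :=
    IsLocalization.map_units (M := Submonoid.powers _) _ ⟨m, N, rfl⟩
  have hmf : MvPowerSeries.map φ (m * f) = 0 := by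
    simpa only [m, _root_.map_mul, map_pow, map_prod, MvPowerSeries.map_X] using hN
  have hnil : (m * f) ^ n = 0 := by
    ext e
    have := coeff_pow_mem (I := RingHom.ker φ) (f := m * f)
      (fun e => by rw [RingHom.mem_ker, ← MvPowerSeries.coeff_map, hmf, map_zero]) n e
    rwa [hn, Ideal.zero_eq_bot, Ideal.mem_bot] at this
  have hw : (x * (u * algebraMap _ _ m)) ^ n = 0 := by
    rw [← mul_assoc, h, mul_comm, ← _root_.map_mul, ← map_pow, hnil, map_zero]
  rw [mul_pow] at hw
  exact ⟨n, ((hu.mul hm).pow n).mul_left_eq_zero.mp hw⟩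

theorem LaurentRing.map_surjective {B : Type*} [CommRing B] {φ : R →+* B}
    (hφ : Function.Surjective φ) : Function.Surjective (LaurentRing.map (D := D) φ) := by
  intro y
  obtain ⟨⟨g, ⟨_, N, rfl⟩⟩, h⟩ := IsLocalization.surj
    (Submonoid.powers (∏ d : D, (MvPowerSeries.X d : MvPowerSeries D B))) y
  choose c hc using hφ
  -- The numerator is lifted coefficient by coefficient; the denominator is a product of variables
  -- and lifts to itself.
  let f : MvPowerSeries D R := fun e => c (MvPowerSeries.coeff e g)
  have hm : IsUnit (algebraMap _ (LaurentRing D R) ((∏ d : D, MvPowerSeries.X d : MvPowerSeries D R) ^ N)) :=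
    IsLocalization.map_units (M := Submonoid.powers _) _ ⟨_, N, rfl⟩
  have hmB : IsUnit (algebraMap _ (LaurentRing D B) ((∏ d : D, MvPowerSeries.X d : MvPowerSeries D B) ^ N)) :=
    IsLocalization.map_units (M := Submonoid.powers _) _ ⟨_, N, rfl⟩
  obtain ⟨v, hv⟩ := hm.exists_left_inv
  refine ⟨v * algebraMap _ _ f,
    hmB.mul_left_injective ?_⟩
  have h1 := congrArg (LaurentRing.map φ) hv
  rw [_root_.map_mul, map_algebraMap, map_one, map_pow, map_prod] at h1
  simp only [MvPowerSeries.map_X] at h1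
  have h2 : MvPowerSeries.map φ f = g := by
    ext e
    exact hc _
  beta_reduce
  rw [_root_.map_mul, map_algebraMap, h2, mul_right_comm, h1, one_mul]
  exact h.symm

end NilpotentKernel

theorem module_mul_smul {R M : Type*} [Ring R] [AddCommGroup M] [Module R M] (x y : R) (m : M) :
    (x * y) • m = x • y • m :=
  mul_smul x y m

/-! ### Stable ideals of Laurent rings and annihilators -/

namespace LubinTateSeries

variable {O : Type*} [CommRing O] [IsDomain O] [IsDiscreteValuationRing O]
  [Finite (IsLocalRing.ResidueField O)] (Φ : LubinTateSeries O)
  {D : Type*} {A : Type*} [CommRing A] [Algebra O A]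

/-- The coefficients of `[γ_d]_Φ` come from `O`, and `φ` is `O`-linear. -/
theorem map_shift {B : Type*} [CommRing B] [Algebra O B] (φ : A →ₐ[O] B) (γ : D → Oˣ) (d : D) :
    MvPowerSeries.map (φ : A →+* B) (Φ.shift A γ d) = Φ.shift B γ d := by
  have hA : HasSubst (MvPowerSeries.X d : MvPowerSeries D A) := .X d
  have hB : HasSubst (MvPowerSeries.X d : MvPowerSeries D B) := .X d
  rw [shift, ← subst_map_algebraMap hA, PowerSeries.map_subst hA, MvPowerSeries.map_X, shift,
    ← subst_map_algebraMap hB (Φ.bracket (γ d))]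
  congr 1
  ext n
  exact φ.commutes _

variable [Fintype D]

theorem map_actSeries {B : Type*} [CommRing B] [Algebra O B] (φ : A →ₐ[O] B) (γ : D → Oˣ)
    (f : MvPowerSeries D A) :
    MvPowerSeries.map (φ : A →+* B) (Φ.actSeries A γ f) =
      Φ.actSeries B γ (MvPowerSeries.map (φ : A →+* B) f) := by
  simp only [actSeries, MvPowerSeries.substAlgHom_apply]
  have h : (fun d => MvPowerSeries.map (φ : A →+* B) (Φ.shift A γ d)) = Φ.shift B γ :=
    funext fun d => Φ.map_shift φ γ d
  exact (MvPowerSeries.map_subst (Φ.hasSubst_shift A γ) f).trans (by rw [h])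

theorem map_act {B : Type*} [CommRing B] [Algebra O B] (φ : A →ₐ[O] B) (γ : D → Oˣ)
    (x : LaurentRing D A) :
    LaurentRing.map (φ : A →+* B) (Φ.act A γ x) =
      Φ.act B γ (LaurentRing.map (φ : A →+* B) x) := by
  refine congrFun (congrArg DFunLike.coe (?_ : (LaurentRing.map (φ : A →+* B)).comp (Φ.act A γ) =
    (Φ.act B γ).comp (LaurentRing.map (φ : A →+* B)))) x
  refine IsLocalization.ringHom_ext
    (Submonoid.powers (∏ d : D, (MvPowerSeries.X d : MvPowerSeries D A))) (RingHom.ext fun f => ?_)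
  simp only [RingHom.comp_apply, act_algebraMap, LaurentRing.map_algebraMap]
  rw [map_actSeries]

/-- A nonzero `Γ_•`-stable ideal of `k((t_•))` is the unit ideal. -/
theorem eq_top_of_act_stable {k : Type*} [Field k] [Algebra O k] {J : Ideal (LaurentRing D k)}
    (hact : ∀ γ, ∀ x ∈ J, Φ.act k γ x ∈ J) (hJ : J ≠ ⊥) : J = ⊤ := by
  have h : J.comap (algebraMap (MvPowerSeries D k) (LaurentRing D k)) = ⊤ := by
    refine Φ.eq_top_of_stable (fun d f hf => ?_) (fun γ f hf => ?_) fun h => ?_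
    · rw [Ideal.mem_comap, map_mul, Ideal.unit_mul_mem_iff_mem _ (isUnit_algebraMap_X d)] at hf
      exact hf
    · rw [Ideal.mem_comap, ← act_algebraMap]
      exact hact γ _ hf
    · obtain ⟨x, hx, hx0⟩ := J.ne_bot_iff.mp hJ
      obtain ⟨u, f, hu, hxu⟩ := LaurentRing.exists_mul_eq x
      have hf : f ∈ J.comap (algebraMap (MvPowerSeries D k) (LaurentRing D k)) := by
        rw [Ideal.mem_comap, ← hxu]
        exact J.mul_mem_right u hx
      rw [h, Ideal.mem_bot] at hf
      rw [hf, map_zero] at hxu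
      exact hx0 (hu.mul_left_eq_zero.mp hxu)
  rw [Ideal.eq_top_iff_one, Ideal.mem_comap, map_one] at h
  exact J.eq_top_iff_one.mpr h

/-- A `Γ_•`-stable ideal of `A((t_•))` with nonzero image in `k((t_•))` is the unit ideal. -/
theorem eq_top_of_map_ne_zero {k : Type*} [Field k] [Algebra O k] (φ : A →ₐ[O] k)
    (hφ : Function.Surjective φ) (hker : IsNilpotent (RingHom.ker (φ : A →+* k)))
    {J : Ideal (LaurentRing D A)} (hact : ∀ γ, ∀ x ∈ J, Φ.act A γ x ∈ J) {α : LaurentRing D A}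
    (hαJ : α ∈ J) (hα : LaurentRing.map (φ : A →+* k) α ≠ 0) : J = ⊤ := by
  have hsurj : Function.Surjective (LaurentRing.map (D := D) (φ : A →+* k)) :=
    LaurentRing.map_surjective hφ
  have h : J.map (LaurentRing.map (φ : A →+* k)) = ⊤ := by
    refine Φ.eq_top_of_act_stable (fun γ x hx => ?_) ?_
    · obtain ⟨y, hy, rfl⟩ := (Ideal.mem_map_iff_of_surjective _ hsurj).mp hx
      rw [← map_act]
      exact Ideal.mem_map_of_mem _ (hact γ y hy)
    · exact (Submodule.ne_bot_iff _).mpr ⟨_, Ideal.mem_map_of_mem _ hαJ, hα⟩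
  obtain ⟨j, hj, hj1⟩ := (Ideal.mem_map_iff_of_surjective _ hsurj).mp
    ((Ideal.eq_top_iff_one _).mp h)
  -- `j` is only a lift of 1, but its difference from 1 is nilpotent, so `j` is a unit.
  have hnil := LaurentRing.isNilpotent_of_map_eq_zero (φ : A →+* k) hker (x := 1 - j)
    (by rw [map_sub, map_one, hj1, sub_self])
  refine J.eq_top_of_isUnit_mem hj ?_
  simpa using hnil.isUnit_one_sub

/-- The ideal of elements of `A((t_•))` annihilating a submodule of an `A((t_•))[Γ_•]`-module. -/
noncomputable def annihilator {M : Type*} [AddCommGroup M] [Module (Φ.SkewGroupRing D A) M]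
    (M' : Submodule (Φ.SkewGroupRing D A) M) : Ideal (LaurentRing D A) where
  carrier := {x | ∀ m ∈ M', Φ.ofLaurent D A x • m = 0}
  add_mem' hx hy m hm := by rw [map_add, add_smul, hx m hm, hy m hm, add_zero]
  zero_mem' m _ := by rw [map_zero, zero_smul]
  smul_mem' c x hx m hm := by rw [smul_eq_mul, map_mul, module_mul_smul, hx m hm, smul_zero]

/-- Writing `m = γ γ⁻¹ m` gives `(γ * x) m = γ x (γ⁻¹ m)`, and `γ⁻¹ m` again lies in the submodule.
-/
theorem act_mem_annihilator {M : Type*} [AddCommGroup M] [Module (Φ.SkewGroupRing D A) M]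
    (M' : Submodule (Φ.SkewGroupRing D A) M) (γ : D → Oˣ) {x : LaurentRing D A}
    (hx : x ∈ Φ.annihilator M') : Φ.act A γ x ∈ Φ.annihilator M' := by
  intro m hm
  have h : m = Φ.ofGroup D A γ • Φ.ofGroup D A γ⁻¹ • m := by
    rw [← module_mul_smul, ← map_mul, mul_inv_cancel, map_one, one_smul]
  rw [h, ← module_mul_smul, ← ofGroup_mul_ofLaurent, module_mul_smul, hx _ (M'.smul_mem _ hm), smul_zero]

end LubinTateSeries

end LubinTate

/-- `K / F / ℚ_p` are finite extensions, `Φ` is a Lubin–Tate power series over `𝒪_F`, `A = 𝒪_K / I`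
is a finite nonzero quotient of `𝒪_K` with residue field `k`, and `Γ_• = D → 𝒪_Fˣ`. -/
theorem mainTheorem2 (p : ℕ) [Fact p.Prime]
    (F K : Type*) [Field F] [Field K] [Algebra ℚ_[p] F] [Algebra ℚ_[p] K] [Algebra F K]
    [IsScalarTower ℚ_[p] F K] [FiniteDimensional ℚ_[p] F] [FiniteDimensional ℚ_[p] K]
    (Φ : LubinTate.LubinTateSeries (LubinTate.integers p F))
    (I : Ideal (LubinTate.integers p K))
    [Finite (LubinTate.integers p K ⧸ I)] [Nontrivial (LubinTate.integers p K ⧸ I)]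
    (D : Type*) [Fintype D]
    (M : Type*) [AddCommGroup M] [Module (Φ.SkewGroupRing D (LubinTate.integers p K ⧸ I)) M]
    (M' : Submodule (Φ.SkewGroupRing D (LubinTate.integers p K ⧸ I)) M)
    (α : LubinTate.LaurentRing D (LubinTate.integers p K ⧸ I))
    (hα : LubinTate.LaurentRing.map (IsLocalRing.residue (LubinTate.integers p K ⧸ I)) α ≠ 0)
    (hM' : ∀ x ∈ M', Φ.ofLaurent D (LubinTate.integers p K ⧸ I) α • x = 0) :
    M' = ⊥ := by
  let A := LubinTate.integers p K ⧸ I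
  let φ : A →ₐ[LubinTate.integers p F] IsLocalRing.ResidueField A :=
    IsScalarTower.toAlgHom (LubinTate.integers p F) A (IsLocalRing.ResidueField A)
  have hker : IsNilpotent (RingHom.ker (φ : A →+* IsLocalRing.ResidueField A)) := by
    change IsNilpotent (RingHom.ker (IsLocalRing.residue A))
    -- The kernel is the maximal ideal of a finite local ring; it equals the Jacobson radical, which
    -- is nilpotent in an Artinian ring.
    rw [IsLocalRing.ker_residue, ← IsLocalRing.jacobson_eq_maximalIdeal ⊥ bot_ne_top]
    exact IsArtinianRing.isNilpotent_jacobson_bot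
  have h : Φ.annihilator M' = ⊤ :=
    Φ.eq_top_of_map_ne_zero φ IsLocalRing.residue_surjective hker
      (fun γ _ hx => Φ.act_mem_annihilator M' γ hx) (α := α) hM' hα
  refine (Submodule.eq_bot_iff _).mpr fun m hm => ?_
  have h1 : Φ.ofLaurent D A 1 • m = 0 := (Ideal.eq_top_iff_one _).mp h m hm
  rwa [map_one, one_smul] at h1
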